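/- A C*-dynamical system $(\mathcal A,G,\alpha)$ consists of a unital C*-algebra $\mathcal A$, a compact (Hausdorff) group $G$ and a strongly continuous homomorphism $\alpha:G\to\mathrm{Aut}(\mathcal A)$ into the group of $*$-automorphisms. It is called free if its Ellwood map $$\Phi:\mathcal A\otimes_{\mathrm{alg}}\mathcal A\to C(G,\mathcal A),\qquad \Phi(x\otimes y)(g)=x\,\alpha_g(y),$$ has dense range for the supremum norm. Theorem. Let $(\mathcal A,G,\alpha)$ be a free C*-dynamical system and let $1\to Z\to\hat G\xrightarrow{q}G\to1$ be a central extension of compact groups. Let $(\hat{\mathcal A},Z,\theta)$ be a free C*-dynamical system whose fixed point algebra is $\mathcal A\subseteq\hat{\mathcal A}$. Let $\hat\alpha:\hat G\to\mathrm{Aut}(\hat{\mathcal A})$ be a strongly continuous action with $\hat\alpha_{\hat g}|_{\mathcal A}=\alpha_{q(\hat g)}$ for all $\hat g\in\hat G$ and $\hat\alpha_z=\theta_z$ for all $z\in Z$. For $\chi$ in the Pontryagin dual $Z^*$ (written additively) put $\hat A(\chi)=\{x\in\hat{\mathcal A}:\theta_z(x)=\chi(z)x\text{ for all }z\in Z\}$,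 and for $\chi,\chi'\in Z^*$ let $C(\hat G)(\chi')\otimes\hat A(\chi+\chi')$ denote the space of all continuous maps $f:\hat G\to\hat A(\chi+\chi')$ with $f(z\hat g)=\chi'(z)f(\hat g)$ for all $z\in Z$ and $\hat g\in\hat G$, with the supremum norm. Then: 1. For all $\chi,\chi'\in Z^*$ the map $$\Phi_{(\chi,\chi')}:\hat A(\chi)\otimes_{\mathrm{alg}}\hat A(\chi')\to C(\hat G)(\chi')\otimes\hat A(\chi+\chi'),\qquad \Phi_{(\chi,\chi')}(s\otimes t)(\hat g)=s\,\hat\alpha_{\hat g}(t),$$ has dense range. 2. The C*-dynamical system $(\hat{\mathcal A},\hat G,\hat\alpha)$ is free. -/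

import Mathlib

open scoped TensorProduct

/-- A C*-dynamical system `(A, G, α)`: a strongly continuous action `α : G → Aut(A)` of the
topological group `G` on the unital C*-algebra `A` by unital *-automorphisms. -/
structure CStarDynSystem (G A : Type*) [Group G] [TopologicalSpace G] [CStarAlgebra A] where
  /-- the action as a group homomorphism into the *-automorphisms -/
  act : G →* (A ≃⋆ₐ[ℂ] A)
  /-- strong continuity -/
  continuous_act : ∀ a : A, Continuous fun g : G => act g a

namespace CStarDynSystem

variable {G A : Type*} [Group G] [TopologicalSpace G] [CStarAlgebra A]

/-- The fixed point algebra of a C*-dynamical system, as a unital *-subalgebra. -/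
def fixedPointAlgebra (α : CStarDynSystem G A) : StarSubalgebra ℂ A where
  carrier := {x | ∀ g, α.act g x = x}
  mul_mem' := by
    intro a b ha hb g
    rw [map_mul, ha g, hb g]
  add_mem' := by
    intro a b ha hb g
    rw [map_add, ha g, hb g]
  algebraMap_mem' := by
    intro r g
    rw [Algebra.algebraMap_eq_smul_one, map_smul, map_one]
  star_mem' := by
    intro a ha g
    rw [map_star, ha g]

/-- The Ellwood map `Φ : A ⊗ A → C(G, A)`, `Φ(x ⊗ y)(g) = x α_g(y)`, on the algebraic tensor
product over `ℂ`. -/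
noncomputable def ellwoodMap (α : CStarDynSystem G A) : A ⊗[ℂ] A →ₗ[ℂ] C(G, A) :=
  TensorProduct.lift <| LinearMap.mk₂ ℂ
    (fun x y => (⟨fun g => x * α.act g y, continuous_const.mul (α.continuous_act y)⟩ : C(G, A)))
    (fun x x' y => by ext g; simp [add_mul])
    (fun c x y => by ext g; simp)
    (fun x y y' => by ext g; simp [mul_add])
    (fun c x y => by ext g; simp)

@[simp]
theorem ellwoodMap_tmul (α : CStarDynSystem G A) (x y : A) (g : G) :
    α.ellwoodMap (x ⊗ₜ[ℂ] y) g = x * α.act g y := rfl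

/-- A C*-dynamical system is free if its Ellwood map has dense range in `C(G, A)`. For compact `G`
the topology of `C(G, A)` is the one of the supremum norm. -/
def IsFree (α : CStarDynSystem G A) : Prop := DenseRange α.ellwoodMap

end CStarDynSystem

section Isotypic

variable {Z Ghat Ahat : Type*} [CommGroup Z] [TopologicalSpace Z] [Group Ghat]
  [TopologicalSpace Ghat] [CStarAlgebra Ahat]

/-- The isotypic component `Â(χ) = {x : θ_z(x) = χ(z) x for all z}` of a C*-dynamical system with
Abelian group `Z`, for a character `χ` of `Z`. -/
def CStarDynSystem.isotypic (θ : CStarDynSystem Z Ahat) (χ : PontryaginDual Z) :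
    Submodule ℂ Ahat where
  carrier := {x | ∀ z, θ.act z x = (χ z : ℂ) • x}
  add_mem' := by
    intro a b ha hb z
    rw [map_add, ha z, hb z, smul_add]
  zero_mem' := by
    intro z
    rw [map_zero, smul_zero]
  smul_mem' := by
    intro c x hx z
    rw [map_smul, hx z, smul_comm]

/-- The space `C(Ĝ)(χ') ⊗ Â(χ)` of all continuous maps `f : Ĝ → Â(χ)` such that
`f(zg) = χ'(z) f(g)` for all `g ∈ Ĝ` and `z ∈ Z`. Here `ι` is the inclusion of `Z` into `Ĝ`. It
carries the topology of `C(Ĝ, Â)`. -/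
def equivariantMaps (ι : Z →* Ghat) (θ : CStarDynSystem Z Ahat) (χ' χ : PontryaginDual Z) :
    Submodule ℂ C(Ghat, Ahat) where
  carrier := {f | (∀ g, f g ∈ θ.isotypic χ) ∧ ∀ g z, f (ι z * g) = (χ' z : ℂ) • f g}
  add_mem' := by
    rintro a b ⟨ha, ha'⟩ ⟨hb, hb'⟩
    refine ⟨fun g => (θ.isotypic χ).add_mem (ha g) (hb g), fun g z => ?_⟩
    simp [ha', hb']
  zero_mem' := ⟨fun _ => (θ.isotypic χ).zero_mem, fun g z => by simp⟩
  smul_mem' := by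
    rintro c x ⟨hx, hx'⟩
    refine ⟨fun g => (θ.isotypic χ).smul_mem c (hx g), fun g z => ?_⟩
    simp [hx', smul_comm c]

theorem ellwoodMap_mapIncl_mem (ι : Z →* Ghat) (hι : ι.range ≤ Subgroup.center Ghat)
    (θ : CStarDynSystem Z Ahat) (αh : CStarDynSystem Ghat Ahat)
    (hθ : ∀ z x, αh.act (ι z) x = θ.act z x) (χ χ' : PontryaginDual Z)
    (w : θ.isotypic χ ⊗[ℂ] θ.isotypic χ') :
    (αh.ellwoodMap ∘ₗ TensorProduct.mapIncl (θ.isotypic χ) (θ.isotypic χ')) w ∈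
      equivariantMaps ι θ χ' (χ * χ') := by
  induction w with
  | zero => rw [map_zero]; exact Submodule.zero_mem _
  | add a b ha hb => rw [map_add]; exact Submodule.add_mem _ ha hb
  | tmul s t =>
    refine ⟨fun g z => ?_, fun g z => ?_⟩
    · have hc : ι z * g = g * ι z :=
        (Subgroup.mem_center_iff.mp (hι ⟨z, rfl⟩) g).symm
      have h1 : θ.act z (αh.act g (t : Ahat)) = (χ' z : ℂ) • αh.act g (t : Ahat) := by
        rw [← hθ, ← StarAlgEquiv.mul_apply, ← map_mul, hc, map_mul, StarAlgEquiv.mul_apply, hθ,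
          t.2 z, map_smul]
      change θ.act z ((s : Ahat) * αh.act g (t : Ahat)) =
        ((χ z * χ' z : Circle) : ℂ) • ((s : Ahat) * αh.act g (t : Ahat))
      rw [map_mul, s.2 z, h1, smul_mul_smul_comm, Circle.coe_mul]
    · have hc : ι z * g = g * ι z :=
        (Subgroup.mem_center_iff.mp (hι ⟨z, rfl⟩) g).symm
      change (s : Ahat) * αh.act (ι z * g) (t : Ahat) =
        (χ' z : ℂ) • ((s : Ahat) * αh.act g (t : Ahat))
      rw [hc, map_mul, StarAlgEquiv.mul_apply, hθ, t.2 z, map_smul, mul_smul_comm]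

/-- The map `Φ_(χ,χ') : Â(χ) ⊗ Â(χ') → C(Ĝ)(χ') ⊗ Â(χ + χ')`, `Φ_(χ,χ')(s ⊗ t)(g) = s α̂_g(t)`, i.e.
the Ellwood map of `(Â, Ĝ, α̂)` between the isotypic components for `(χ, χ')`; the dual of `Z` is
written multiplicatively. -/
noncomputable def isotypicEllwoodMap (ι : Z →* Ghat) (hι : ι.range ≤ Subgroup.center Ghat)
    (θ : CStarDynSystem Z Ahat) (αh : CStarDynSystem Ghat Ahat)
    (hθ : ∀ z x, αh.act (ι z) x = θ.act z x) (χ χ' : PontryaginDual Z) :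
    θ.isotypic χ ⊗[ℂ] θ.isotypic χ' →ₗ[ℂ] equivariantMaps ι θ χ' (χ * χ') :=
  LinearMap.codRestrict _
    (αh.ellwoodMap ∘ₗ TensorProduct.mapIncl (θ.isotypic χ) (θ.isotypic χ'))
    (ellwoodMap_mapIncl_mem ι hι θ αh hθ χ χ')

theorem isotypicEllwoodMap_tmul (ι : Z →* Ghat) (hι : ι.range ≤ Subgroup.center Ghat)
    (θ : CStarDynSystem Z Ahat) (αh : CStarDynSystem Ghat Ahat)
    (hθ : ∀ z x, αh.act (ι z) x = θ.act z x) (χ χ' : PontryaginDual Z)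
    (s : θ.isotypic χ) (t : θ.isotypic χ') (g : Ghat) :
    (isotypicEllwoodMap ι hι θ αh hθ χ χ' (s ⊗ₜ[ℂ] t) : C(Ghat, Ahat)) g =
      (s : Ahat) * αh.act g (t : Ahat) := rfl

end Isotypic

/-! Freeness of `θ` puts the unit in the algebraic span of Â(χ)Â(χ⁻¹) for every χ
(`IsFree.one_mem_isotypic_inv_mul_isotypic`). Write 1 = ∑ p s with p ∈ Â(χ), s ∈ Â(χ⁻¹), and 1 = ∑ u
v with u ∈ Â(χ'⁻¹), v ∈ Â(χ'). An equivariant f is then the sum of the maps g ↦ p (s f(g) α̂_g(u))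
α̂_g(v). Each inner map has both characters trivial, so it descends to a map G → A, which freeness
of `α` approximates by the Ellwood map. The outer p and v are absorbed into the two tensor legs.

Freeness of α̂ is a separate local argument over G. On a coset Zg₀ the Ellwood map of α̂ reproduces
that of `θ`, so freeness of `θ` gives approximation on each fibre. Partitions of unity on G glue
these, since functions on G times the unit are limits of the Ellwood map by descent. -/

open MeasureTheory

namespace CStarDynSystem

/-! ### Two-sided multiplication and the Ellwood map -/

section Orbit

variable {G A : Type*} [Group G] [TopologicalSpace G] [CStarAlgebra A]

/-- The orbit map `y ↦ (g ↦ α_g(y))`. -/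
def orbitMap (α : CStarDynSystem G A) : A →ₗ[ℂ] C(G, A) where
  toFun y := ⟨fun g => α.act g y, α.continuous_act y⟩
  map_add' x y := by ext g; simp
  map_smul' c y := by ext g; simp

@[simp]
theorem orbitMap_apply (α : CStarDynSystem G A) (y : A) (g : G) :
    α.orbitMap y g = α.act g y := rfl

/-- The operator `f ↦ (g ↦ a f(g) α_g(b))` on `C(G, A)`. -/
noncomputable def sandwich [CompactSpace G] (α : CStarDynSystem G A) (a b : A) : C(G, A) →L[ℂ] C(G, A) where
  toFun f := ContinuousMap.const G a * f * α.orbitMap b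
  map_add' f g := by rw [mul_add, add_mul]
  map_smul' c f := by ext g; simp
  cont := (continuous_const.mul continuous_id).mul continuous_const

@[simp]
theorem sandwich_apply [CompactSpace G] (α : CStarDynSystem G A) (a b : A) (f : C(G, A)) (g : G) :
    α.sandwich a b f g = a * f g * α.act g b := rfl

theorem sandwich_ellwoodMap_tmul [CompactSpace G] (α : CStarDynSystem G A) (a b x y : A) :
    α.sandwich a b (α.ellwoodMap (x ⊗ₜ[ℂ] y)) = α.ellwoodMap ((a * x) ⊗ₜ[ℂ] (y * b)) := by
  ext g
  simp [mul_assoc]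

theorem norm_orbitMap_le [CompactSpace G] (α : CStarDynSystem G A) (y : A) :
    ‖α.orbitMap y‖ ≤ ‖y‖ := by
  refine (ContinuousMap.norm_le _ (norm_nonneg y)).2 fun g => ?_
  exact (NonUnitalStarAlgHom.norm_map (α.act g) (α.act g).injective y).le

end Orbit

/-! ### Isotypic components and Fourier coefficients -/

section Isotypic

variable {Z B : Type*} [CommGroup Z] [TopologicalSpace Z] [CStarAlgebra B]

theorem mem_isotypic {θ : CStarDynSystem Z B} {χ : PontryaginDual Z} {x : B} :
    x ∈ θ.isotypic χ ↔ ∀ z, θ.act z x = (χ z : ℂ) • x := Iff.rfl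

theorem mem_isotypic_one {θ : CStarDynSystem Z B} {x : B} :
    x ∈ θ.isotypic 1 ↔ ∀ z, θ.act z x = x := by
  simp [mem_isotypic]

theorem mul_mem_isotypic {θ : CStarDynSystem Z B} {χ χ' : PontryaginDual Z} {x y : B}
    (hx : x ∈ θ.isotypic χ) (hy : y ∈ θ.isotypic χ') : x * y ∈ θ.isotypic (χ * χ') := fun z => by
  change _ = ((χ z * χ' z : Circle) : ℂ) • (x * y)
  rw [map_mul, hx z, hy z, smul_mul_smul_comm, Circle.coe_mul]

theorem isotypic_mul_le (θ : CStarDynSystem Z B) (χ χ' : PontryaginDual Z) :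
    θ.isotypic χ * θ.isotypic χ' ≤ θ.isotypic (χ * χ') :=
  Submodule.mul_le.2 fun _ hx _ hy => mul_mem_isotypic hx hy

theorem inv_val_mem_isotypic_one {θ : CStarDynSystem Z B} {u : Bˣ}
    (hu : (u : B) ∈ θ.isotypic 1) : ((u⁻¹ : Bˣ) : B) ∈ θ.isotypic 1 := by
  rw [mem_isotypic_one] at hu ⊢
  intro z
  refine (Units.inv_eq_of_mul_eq_one_right (u := u) ?_).symm
  conv_lhs => rw [← hu z]
  rw [← map_mul, Units.mul_inv, map_one]

section Average

variable [IsTopologicalGroup Z] [CompactSpace Z] [MeasurableSpace Z] [BorelSpace Z]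
  (μ : Measure Z) [IsProbabilityMeasure μ]

theorem integrable_conj_smul (χ : PontryaginDual Z) (f : C(Z, B)) :
    Integrable (fun z => (χ z⁻¹ : ℂ) • f z) μ := by
  have : Continuous fun z => (χ z⁻¹ : ℂ) • f z :=
    (continuous_subtype_val.comp ((map_continuous χ).comp continuous_inv)).smul f.continuous
  exact this.integrable_of_hasCompactSupport (HasCompactSupport.of_compactSpace _)

/-- The Fourier coefficient `∫ χ(z)⁻¹ f(z) dz` of a continuous function `f` on `Z`. -/
noncomputable def fourierCoeff (χ : PontryaginDual Z) : C(Z, B) →ₗ[ℂ] B where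
  toFun f := ∫ z, (χ z⁻¹ : ℂ) • f z ∂μ
  map_add' f g := by
    simp only [ContinuousMap.add_apply, smul_add]
    exact integral_add (integrable_conj_smul μ χ f) (integrable_conj_smul μ χ g)
  map_smul' c f := by
    simp only [ContinuousMap.smul_apply, smul_comm _ c, integral_smul, RingHom.id_apply]

theorem fourierCoeff_apply (χ : PontryaginDual Z) (f : C(Z, B)) :
    fourierCoeff μ χ f = ∫ z, (χ z⁻¹ : ℂ) • f z ∂μ := rfl

theorem norm_fourierCoeff_le (χ : PontryaginDual Z) (f : C(Z, B)) :
    ‖fourierCoeff μ χ f‖ ≤ ‖f‖ := by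
  rw [fourierCoeff_apply]
  refine (norm_integral_le_of_norm_le_const (C := ‖f‖) (.of_forall fun z => ?_)).trans (by simp)
  rw [norm_smul, Circle.norm_coe, one_mul]
  exact f.norm_coe_le_norm z

theorem fourierCoeff_const_mul (χ : PontryaginDual Z) (a : B) (f : C(Z, B)) :
    fourierCoeff μ χ (ContinuousMap.const Z a * f) = a * fourierCoeff μ χ f := by
  simp only [fourierCoeff_apply]
  rw [← integral_const_mul_of_integrable (integrable_conj_smul μ χ f)]
  simp

theorem fourierCoeff_mul_const (χ : PontryaginDual Z) (a : B) (f : C(Z, B)) :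
    fourierCoeff μ χ (f * ContinuousMap.const Z a) = fourierCoeff μ χ f * a := by
  simp only [fourierCoeff_apply]
  rw [← integral_mul_const_of_integrable (integrable_conj_smul μ χ f)]
  simp

/-- Substituting w z for z in the Haar integral pulls out the factor χ(w). -/
theorem fourierCoeff_orbitMap_mem [μ.IsMulLeftInvariant] (θ : CStarDynSystem Z B)
    (χ : PontryaginDual Z) (y : B) : fourierCoeff μ χ (θ.orbitMap y) ∈ θ.isotypic χ := by
  intro w
  let L : B →L[ℂ] B :=
    ⟨(θ.act w : B →ₗ[ℂ] B), (NonUnitalStarAlgHom.isometry (θ.act w) (θ.act w).injective).continuous⟩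
  have h1 : θ.act w (fourierCoeff μ χ (θ.orbitMap y)) =
      ∫ z, (χ z⁻¹ : ℂ) • θ.act (w * z) y ∂μ := by
    rw [fourierCoeff_apply]
    refine (L.integral_comp_comm (integrable_conj_smul μ χ (θ.orbitMap y))).symm.trans ?_
    refine integral_congr_ae (.of_forall fun z => ?_)
    change θ.act w ((χ z⁻¹ : ℂ) • θ.act z y) = _
    change _ = (χ z⁻¹ : ℂ) • θ.act (w * z) y
    rw [map_smul, map_mul θ.act, StarAlgEquiv.mul_apply]
  rw [h1, fourierCoeff_apply, ← integral_smul,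
    ← integral_mul_left_eq_self (fun z => (χ w : ℂ) • (χ z⁻¹ : ℂ) • θ.orbitMap y z) w]
  refine integral_congr_ae (.of_forall fun z => ?_)
  simp only [orbitMap_apply, smul_smul]
  rw [← Circle.coe_mul, ← map_mul]
  simp

end Average

/-- For a free system of a compact Abelian group the products of the isotypic components for `χ⁻¹`
and `χ` span an ideal of the fixed point algebra that contains the unit. -/
theorem IsFree.one_mem_isotypic_inv_mul_isotypic [IsTopologicalGroup Z] [CompactSpace Z]
    {θ : CStarDynSystem Z B} (hθ : θ.IsFree) (χ : PontryaginDual Z) :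
    (1 : B) ∈ θ.isotypic χ⁻¹ * θ.isotypic χ := by
  borelize Z
  let μ : Measure Z := Measure.haarMeasure ⊤
  have : IsProbabilityMeasure μ := ⟨by
    simpa using Measure.haarMeasure_self (K₀ := (⊤ : TopologicalSpace.PositiveCompacts Z))⟩
  -- The test function is the character itself: its χ-coefficient is the unit.
  let f : C(Z, B) := ⟨fun z => (χ z : ℂ) • (1 : B),
    (continuous_subtype_val.comp (map_continuous χ)).smul continuous_const⟩
  obtain ⟨_, ⟨w, rfl⟩, hw⟩ := Metric.mem_closure_iff.1 (hθ f) 1 one_pos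
  -- Averaging over `Z`, a contraction that fixes the unit.
  let P : B →ₗ[ℂ] B := fourierCoeff μ 1 ∘ₗ θ.orbitMap
  have hP : ∀ x, ‖P x‖ ≤ ‖x‖ := fun x =>
    (norm_fourierCoeff_le μ 1 _).trans (θ.norm_orbitMap_le x)
  have hP1 : P 1 = 1 := by
    change ∫ z, (((1 : PontryaginDual Z) z⁻¹ : Circle) : ℂ) • θ.act z 1 ∂μ = 1
    simp
  have hf : fourierCoeff μ χ f = 1 := by
    change ∫ z, (χ z⁻¹ : ℂ) • (χ z : ℂ) • (1 : B) ∂μ = 1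
    simp only [smul_smul]
    simp only [← Circle.coe_mul, ← map_mul]
    simp
  have hmem : ∀ w, P (fourierCoeff μ χ (θ.ellwoodMap w)) ∈
      θ.isotypic χ⁻¹ * θ.isotypic χ := by
    intro w
    induction w with
    | zero => simp
    | add a b ha hb => simpa only [map_add] using Submodule.add_mem _ ha hb
    | tmul x y =>
      have ht := fourierCoeff_orbitMap_mem μ θ χ y
      have h1 : θ.ellwoodMap (x ⊗ₜ[ℂ] y) = ContinuousMap.const Z x * θ.orbitMap y := rfl
      rw [h1, fourierCoeff_const_mul]
      generalize fourierCoeff μ χ (θ.orbitMap y) = t at ht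
      -- As `t` transforms by χ, averaging `x * t` extracts the χ⁻¹-coefficient of `x`.
      have h2 : P (x * t) = fourierCoeff μ χ⁻¹ (θ.orbitMap x) * t := by
        rw [← fourierCoeff_mul_const]
        refine integral_congr_ae (.of_forall fun z => ?_)
        change (((1 : PontryaginDual Z) z⁻¹ : Circle) : ℂ) • θ.act z (x * t) =
          ((χ z⁻¹)⁻¹ : Circle) • (θ.act z x * t)
        rw [map_mul, ht z]
        simp [Circle.smul_def]
      rw [h2]
      exact Submodule.mul_mem_mul (fourierCoeff_orbitMap_mem μ θ χ⁻¹ x) ht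
  set v := P (fourierCoeff μ χ (θ.ellwoodMap w))
  -- Both maps are contractive, so `v` stays within distance 1 of the unit and is invertible by the
  -- Neumann series.
  have hlt : ‖1 - v‖ < 1 := by
    have : 1 - v = P (fourierCoeff μ χ (f - θ.ellwoodMap w)) := by
      rw [map_sub, map_sub, hf, hP1]
    rw [this]
    refine ((hP _).trans (norm_fourierCoeff_le μ χ _)).trans_lt ?_
    rwa [← dist_eq_norm]
  obtain ⟨u, hu⟩ : ∃ u : Bˣ, (u : B) = v := ⟨Units.oneSub (1 - v) hlt, by simp⟩
  have hvm : v ∈ θ.isotypic χ⁻¹ * θ.isotypic χ := hmem w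
  have hv1 : v ∈ θ.isotypic 1 := by
    simpa using isotypic_mul_le θ _ _ hvm
  have hinv := inv_val_mem_isotypic_one (θ := θ) (u := u) (by rwa [hu])
  -- The inverse of `v` is again fixed, so the right factor Â(χ) absorbs it and the unit is reached
  -- exactly, not only in the closure.
  rw [← u.mul_inv, hu]
  have hle : θ.isotypic χ * θ.isotypic 1 ≤ θ.isotypic χ := by
    simpa using isotypic_mul_le θ χ 1
  have := Submodule.mul_mem_mul hvm hinv
  rw [mul_assoc] at this
  exact mul_le_mul_right hle _ this

end Isotypic

end CStarDynSystem

namespace CStarDynSystem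

/-! ### Descent to the base system -/

section Descent

variable {Z Ghat G A Ahat : Type*} [CommGroup Z] [TopologicalSpace Z] [Group Ghat]
  [TopologicalSpace Ghat] [CompactSpace Ghat]
  [Group G] [TopologicalSpace G] [T2Space G] [CStarAlgebra A] [CStarAlgebra Ahat]

/-- Continuous maps on `Ĝ` that are constant on the cosets of `Z` and take values in the fixed
point algebra of `θ` are approximated by the Ellwood map on the fixed point algebra. -/
theorem IsFree.equivariantMaps_one_le_topologicalClosure
    (E : GroupExtension Z Ghat G) (hq : Continuous E.rightHom)
    {α : CStarDynSystem G A} (hα : α.IsFree) (θ : CStarDynSystem Z Ahat)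
    (j : A →⋆ₐ[ℂ] Ahat) (hj : Function.Injective j) (hfix : j.range = θ.fixedPointAlgebra)
    (αh : CStarDynSystem Ghat Ahat)
    (hlift : ∀ (g : Ghat) (a : A), αh.act g (j a) = j (α.act (E.rightHom g) a)) :
    equivariantMaps E.inl θ 1 1 ≤ (LinearMap.range (αh.ellwoodMap ∘ₗ
      TensorProduct.mapIncl (θ.isotypic 1) (θ.isotypic 1))).topologicalClosure := by
  rintro F ⟨hF1, hF2⟩
  have hjc := (NonUnitalStarAlgHom.isometry j hj).isEmbedding
  have hquot : Topology.IsQuotientMap E.rightHom :=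
    hq.isClosedMap.isQuotientMap hq E.rightHom_surjective
  have hjmem : ∀ a, j a ∈ θ.isotypic 1 := fun a => by
    have : j a ∈ θ.fixedPointAlgebra := hfix ▸ ⟨a, rfl⟩
    exact mem_isotypic_one.2 this
  have hval : ∀ g, ∃ a, j a = F g := fun g => by
    have : F g ∈ j.range := by
      rw [hfix]
      exact mem_isotypic_one.1 (hF1 g)
    exact this
  have hinv : ∀ g h, E.rightHom g = E.rightHom h → F g = F h := fun g h hgh => by
    have : g * h⁻¹ ∈ E.inl.range := by
      rw [E.range_inl_eq_ker_rightHom, MonoidHom.mem_ker]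
      simp [hgh]
    obtain ⟨z, hz⟩ := this
    have h1 := hF2 h z
    rw [hz] at h1
    simpa using h1
  choose s hs using E.rightHom_surjective
  choose a ha using hval
  have hak : ∀ g, j (a (s (E.rightHom g))) = F g := fun g => by
    rw [ha]
    exact hinv _ _ (hs _)
  -- The section `s` need not be continuous; continuity is tested after the quotient map and the
  -- isometry `j`.
  have hkc : Continuous fun x => a (s x) := by
    rw [hquot.continuous_iff, hjc.continuous_iff]
    exact F.continuous.congr fun g => (hak g).symm
  let K : C(G, A) := ⟨fun x => a (s x), hkc⟩
  let qc : C(Ghat, G) := ⟨E.rightHom, hq⟩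
  let jc : C(A, Ahat) := ⟨j, hjc.continuous⟩
  let L : C(G, A) → C(Ghat, Ahat) := fun k => jc.comp (k.comp qc)
  have hL : Continuous L :=
    (ContinuousMap.continuous_postcomp jc).comp (ContinuousMap.continuous_precomp qc)
  have hLK : L K = F := by
    ext g
    exact hak g
  rw [← hLK]
  refine map_mem_closure hL (hα K) ?_
  rintro _ ⟨w, rfl⟩
  change L (α.ellwoodMap w) ∈ LinearMap.range _
  induction w with
  | zero =>
    have : L (α.ellwoodMap 0) = 0 := by
      ext g
      simp [L, jc]
    rw [this]
    exact Submodule.zero_mem _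
  | add x y hx hy =>
    have : L (α.ellwoodMap (x + y)) = L (α.ellwoodMap x) + L (α.ellwoodMap y) := by
      ext g
      simp [L, jc]
    rw [this]
    exact Submodule.add_mem _ hx hy
  | tmul x y =>
    refine ⟨(⟨j x, hjmem x⟩ : θ.isotypic 1) ⊗ₜ[ℂ] (⟨j y, hjmem y⟩ : θ.isotypic 1), ?_⟩
    ext g
    change j x * αh.act g (j y) = j (x * α.act (E.rightHom g) y)
    rw [hlift, map_mul]

end Descent

/-! ### Shifting characters by two-sided multiplication -/

section Isotypic

variable {Z Ghat Ahat : Type*} [CommGroup Z] [TopologicalSpace Z] [Group Ghat]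
  [TopologicalSpace Ghat] [CompactSpace Ghat] [CStarAlgebra Ahat]

theorem sandwich_mem_range_ellwoodMap_mapIncl {θ : CStarDynSystem Z Ahat}
    (αh : CStarDynSystem Ghat Ahat) {χ χ' : PontryaginDual Z} {p v : Ahat}
    (hp : p ∈ θ.isotypic χ) (hv : v ∈ θ.isotypic χ') (w : θ.isotypic 1 ⊗[ℂ] θ.isotypic 1) :
    αh.sandwich p v ((αh.ellwoodMap ∘ₗ
        TensorProduct.mapIncl (θ.isotypic 1) (θ.isotypic 1)) w) ∈
      LinearMap.range (αh.ellwoodMap ∘ₗ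
        TensorProduct.mapIncl (θ.isotypic χ) (θ.isotypic χ')) := by
  induction w with
  | zero => simp
  | add a b ha hb =>
    rw [map_add, map_add]
    exact Submodule.add_mem _ ha hb
  | tmul x y =>
    have h1 := mul_mem_isotypic hp x.2
    have h2 := mul_mem_isotypic y.2 hv
    rw [mul_one] at h1
    rw [one_mul] at h2
    refine ⟨(⟨p * x, h1⟩ : θ.isotypic χ) ⊗ₜ[ℂ] (⟨y * v, h2⟩ : θ.isotypic χ'), ?_⟩
    exact (αh.sandwich_ellwoodMap_tmul p v x y).symm

theorem sandwich_mem_equivariantMaps {ι : Z →* Ghat} (hι : ι.range ≤ Subgroup.center Ghat)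
    {θ : CStarDynSystem Z Ahat} {αh : CStarDynSystem Ghat Ahat}
    (hθ : ∀ z x, αh.act (ι z) x = θ.act z x) {χ χ' ψ ψ' : PontryaginDual Z} {a b : Ahat}
    (ha : a ∈ θ.isotypic χ) (hb : b ∈ θ.isotypic χ') {f : C(Ghat, Ahat)}
    (hf : f ∈ equivariantMaps ι θ ψ' ψ) :
    αh.sandwich a b f ∈ equivariantMaps ι θ (ψ' * χ') (χ * ψ * χ') := by
  have hmem := (ellwoodMap_mapIncl_mem ι hι θ αh hθ 1 χ'
    ((⟨1, mem_isotypic_one.2 fun z => map_one _⟩ : θ.isotypic 1) ⊗ₜ[ℂ] (⟨b, hb⟩ : θ.isotypic χ')))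
  have hbg : ∀ g, αh.act g b ∈ θ.isotypic χ' := fun g => by
    have := hmem.1 g
    simpa using this
  have hbz : ∀ g z, αh.act (ι z * g) b = (χ' z : ℂ) • αh.act g b := fun g z => by
    have := hmem.2 g z
    simpa using this
  refine ⟨fun g => mul_mem_isotypic (mul_mem_isotypic ha (hf.1 g)) (hbg g), fun g z => ?_⟩
  change a * f (ι z * g) * αh.act (ι z * g) b =
    ((ψ' z * χ' z : Circle) : ℂ) • (a * f g * αh.act g b)
  have hsmul : ∀ (c d : ℂ) (x y : Ahat), a * c • x * d • y = (c * d) • (a * x * y) := by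
    intro c d x y
    rw [mul_smul_comm c a x, smul_mul_smul_comm]
  rw [hf.2, hbz, Circle.coe_mul]
  exact hsmul _ _ _ _

end Isotypic

end CStarDynSystem

/-! ### Gluing approximations along fibres -/

/-- A submodule of `C(X, B)` is dense if it can approximate every function near every fibre of a
map `q` to a compact Hausdorff space `Y` and its closure is stable under the multiplication with
functions that factor through `q`. -/
theorem Submodule.topologicalClosure_eq_top_of_approx_fibres {X Y B : Type*} [TopologicalSpace X]
    [CompactSpace X] [TopologicalSpace Y] [CompactSpace Y] [T2Space Y] [NormedAddCommGroup B]
    [NormedSpace ℂ B] (q : C(X, Y)) (M : Submodule ℂ C(X, B))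
    (hM : ∀ (h : C(Y, ℝ)) (m : C(X, B)), m ∈ M →
      (⟨fun x => (h (q x) : ℂ) • m x, by fun_prop⟩ : C(X, B)) ∈ M.topologicalClosure)
    (happrox : ∀ (f : C(X, B)) (y : Y) (ε : ℝ), 0 < ε →
      ∃ m ∈ M, ∀ x, q x = y → ‖f x - m x‖ < ε) :
    M.topologicalClosure = ⊤ := by
  refine eq_top_iff.2 fun f _ => ?_
  rw [← SetLike.mem_coe, ← M.isClosed_topologicalClosure.closure_eq, Metric.mem_closure_iff]
  intro ε hε
  choose m hmM hm using fun y => happrox f y (ε / 2) (half_pos hε)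
  let C : Y → Set X := fun y => {x | ε / 2 ≤ ‖f x - m y x‖}
  have hC : ∀ y, IsClosed (C y) := fun y =>
    isClosed_le continuous_const (f.continuous.sub (m y).continuous).norm
  let U : Y → Set Y := fun y => (q '' C y)ᶜ
  -- The image of the bad set is closed and misses `y`, so approximation on one fibre persists over
  -- a neighbourhood of `y`.
  have hU : ∀ y, IsOpen (U y) := fun y => (q.continuous.isClosedMap _ (hC y)).isOpen_compl
  have hyU : ∀ y, y ∈ U y := by
    rintro y ⟨x, hx, hxy⟩
    exact absurd (hm y x hxy) (not_lt.2 hx)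
  obtain ⟨t, ht⟩ := isCompact_univ.elim_finite_subcover U hU
    fun y _ => Set.mem_iUnion.2 ⟨y, hyU y⟩
  obtain ⟨ρ, hρ⟩ := PartitionOfUnity.exists_isSubordinate (ι := t) isClosed_univ
    (fun y => U y) (fun y => hU y) (by simpa [Set.iUnion_subtype] using ht)
  have hsum : ∀ y, ∑ i, ρ i y = 1 := fun y => by
    rw [← finsum_eq_sum_of_fintype]
    exact ρ.sum_eq_one (Set.mem_univ y)
  let F : t → C(X, B) := fun i => ⟨fun x => (ρ i (q x) : ℂ) • m i x, by fun_prop⟩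
  refine ⟨∑ i, F i, Submodule.sum_mem _ fun i _ => hM (ρ i) (m i) (hmM i), ?_⟩
  rw [dist_eq_norm]
  refine ((ContinuousMap.norm_le _ (half_pos hε).le).2 fun x => ?_).trans_lt (half_lt_self hε)
  have h1 : (f - ∑ i, F i) x = ∑ i, (ρ i (q x) : ℂ) • (f x - m i x) := by
    simp only [smul_sub, Finset.sum_sub_distrib, ← Finset.sum_smul, ← Complex.ofReal_sum, hsum]
    simp [F]
  rw [h1]
  refine (norm_sum_le _ _).trans ?_
  calc ∑ i, ‖(ρ i (q x) : ℂ) • (f x - m i x)‖ ≤ ∑ i, ρ i (q x) * (ε / 2) := by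
        refine Finset.sum_le_sum fun i _ => ?_
        rw [norm_smul, Complex.norm_real, Real.norm_of_nonneg (ρ.nonneg i _)]
        by_cases hx : q x ∈ U i
        · refine mul_le_mul_of_nonneg_left ?_ (ρ.nonneg i _)
          by_contra hlt
          exact hx ⟨x, (not_le.1 hlt).le, rfl⟩
        · have : ρ i (q x) = 0 := by
            by_contra h0
            exact hx (hρ i (subset_closure h0))
          simp [this]
    _ = ε / 2 := by rw [← Finset.sum_mul, hsum, one_mul]

/-! ### The main theorem -/

open CStarDynSystem in
theorem mainTheorem4
    {Z Ghat G A Ahat : Type*}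
    [CommGroup Z] [TopologicalSpace Z] [IsTopologicalGroup Z] [CompactSpace Z] [T2Space Z]
    [Group Ghat] [TopologicalSpace Ghat] [IsTopologicalGroup Ghat] [CompactSpace Ghat]
    [T2Space Ghat]
    [Group G] [TopologicalSpace G] [IsTopologicalGroup G] [CompactSpace G] [T2Space G]
    [CStarAlgebra A] [CStarAlgebra Ahat]
    -- the central extension `1 → Z → Ĝ → G → 1` of compact groups
    (E : GroupExtension Z Ghat G)
    (hincl : Continuous E.inl) (hq : Continuous E.rightHom)
    (hcentral : E.inl.range ≤ Subgroup.center Ghat)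
    -- the free system `(A, G, α)`
    (α : CStarDynSystem G A) (hα : α.IsFree)
    -- the free system `(Â, Z, θ)` with fixed point algebra `A`, embedded in `Â` by `j`
    (θ : CStarDynSystem Z Ahat) (hθ : θ.IsFree)
    (j : A →⋆ₐ[ℂ] Ahat) (hj : Function.Injective j) (hfix : j.range = θ.fixedPointAlgebra)
    -- the strongly continuous lift `α̂` of `α`, which restricts to `θ` on `Z`
    (αh : CStarDynSystem Ghat Ahat)
    (hlift : ∀ (g : Ghat) (a : A), αh.act g (j a) = j (α.act (E.rightHom g) a))
    (hres : ∀ (z : Z) (x : Ahat), αh.act (E.inl z) x = θ.act z x) :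
    (∀ χ χ' : PontryaginDual Z,
      DenseRange (isotypicEllwoodMap E.inl hcentral θ αh hres χ χ')) ∧
    αh.IsFree := by
  have hdesc := hα.equivariantMaps_one_le_topologicalClosure E hq θ j hj hfix αh hlift
  refine ⟨fun χ χ' => ?_, ?_⟩
  · have key : ∀ f ∈ equivariantMaps E.inl θ χ' (χ * χ'),
        ∀ a ∈ θ.isotypic χ * θ.isotypic χ⁻¹, ∀ b ∈ θ.isotypic χ'⁻¹ * θ.isotypic χ',
        αh.sandwich a b f ∈ (LinearMap.range (αh.ellwoodMap ∘ₗ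
          TensorProduct.mapIncl (θ.isotypic χ) (θ.isotypic χ'))).topologicalClosure := by
      intro f hf a ha b hb
      induction ha using Submodule.mul_induction_on' with
      | add x _ y _ hx hy =>
        have : αh.sandwich (x + y) b f = αh.sandwich x b f + αh.sandwich y b f := by
          ext g
          simp [add_mul]
        rw [this]
        exact Submodule.add_mem _ hx hy
      | mem_mul_mem p hp s hs =>
        induction hb using Submodule.mul_induction_on' with
        | add x _ y _ hx hy =>
          have : αh.sandwich (p * s) (x + y) f =
              αh.sandwich (p * s) x f + αh.sandwich (p * s) y f := by
            ext g
            simp [mul_add]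
          rw [this]
          exact Submodule.add_mem _ hx hy
        | mem_mul_mem u hu v hv =>
          have h0 := sandwich_mem_equivariantMaps hcentral hres hs hu hf
          -- The characters of `s` and `u` cancel those of `f`, so the descent lemma applies.
          rw [mul_inv_cancel, inv_mul_cancel_left, mul_inv_cancel] at h0
          have h1 : αh.sandwich (p * s) (u * v) f = αh.sandwich p v (αh.sandwich s u f) := by
            ext g
            simp [mul_assoc]
          rw [h1]
          refine map_mem_closure (αh.sandwich p v).continuous (hdesc h0) ?_
          rintro _ ⟨w, rfl⟩
          exact sandwich_mem_range_ellwoodMap_mapIncl αh hp hv w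
    rintro ⟨f, hf⟩
    have h1 : (1 : Ahat) ∈ θ.isotypic χ * θ.isotypic χ⁻¹ := by
      simpa using hθ.one_mem_isotypic_inv_mul_isotypic χ⁻¹
    have hfc := key f hf 1 h1 1 (hθ.one_mem_isotypic_inv_mul_isotypic χ')
    have h2 : αh.sandwich 1 1 f = f := by
      ext g
      simp
    rw [h2] at hfc
    rw [Topology.IsEmbedding.subtypeVal.closure_eq_preimage_closure_image]
    refine closure_mono ?_ hfc
    rintro _ ⟨w, rfl⟩
    exact ⟨_, ⟨w, rfl⟩, rfl⟩
  · have hle : (LinearMap.range (αh.ellwoodMap ∘ₗ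
        TensorProduct.mapIncl (θ.isotypic 1) (θ.isotypic 1))).topologicalClosure ≤
        (LinearMap.range αh.ellwoodMap).topologicalClosure :=
      Submodule.topologicalClosure_mono (LinearMap.range_comp_le_range _ _)
    have htop : (LinearMap.range αh.ellwoodMap).topologicalClosure = ⊤ := by
      refine Submodule.topologicalClosure_eq_top_of_approx_fibres ⟨E.rightHom, hq⟩ _ ?_ ?_
      · rintro h _ ⟨w, rfl⟩
        -- Multiplying Φ(x ⊗ y) by h ∘ q amounts to sandwiching `H` between `x` and `y`, because `H`
        -- has scalar values.
        let H : C(Ghat, Ahat) := ⟨fun x => (h (E.rightHom x) : ℂ) • (1 : Ahat), by fun_prop⟩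
        have hH : H ∈ equivariantMaps E.inl θ 1 1 := by
          refine ⟨fun g => mem_isotypic_one.2 fun z => ?_, fun g z => ?_⟩
          · change θ.act z ((h (E.rightHom g) : ℂ) • (1 : Ahat)) = _
            rw [map_smul, map_one]
            rfl
          · change (h (E.rightHom (E.inl z * g)) : ℂ) • (1 : Ahat) =
              (((1 : PontryaginDual Z) z : Circle) : ℂ) • (h (E.rightHom g) : ℂ) • (1 : Ahat)
            simp
        have hHc := hle (hdesc hH)
        induction w with
        | zero =>
          convert Submodule.zero_mem _ using 1
          ext g
          simp
        | add x y hx hy =>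
          convert Submodule.add_mem _ hx hy using 1
          ext g
          simp
        | tmul x y =>
          have : αh.sandwich x y H ∈ (LinearMap.range αh.ellwoodMap).topologicalClosure := by
            refine map_mem_closure (αh.sandwich x y).continuous hHc ?_
            rintro _ ⟨w, rfl⟩
            induction w with
            | zero => simp
            | add a b ha hb =>
              rw [map_add, map_add]
              exact Submodule.add_mem _ ha hb
            | tmul a b => exact ⟨_, (αh.sandwich_ellwoodMap_tmul x y a b).symm⟩
          convert this using 1
          ext g
          simp [H]
      · intro f y ε hε
        obtain ⟨g₀, rfl⟩ := E.rightHom_surjective y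
        let φ : C(Z, Ahat) := ⟨fun z => f (E.inl z * g₀), by fun_prop⟩
        obtain ⟨_, ⟨w, rfl⟩, hw⟩ := Metric.mem_closure_iff.1 (hθ φ) ε hε
        -- Twisting the second leg by the inverse of `g₀` turns the action of z g₀ into `θ` at z, so
        -- on this fibre the value is the Ellwood map of `θ`.
        refine ⟨αh.ellwoodMap (TensorProduct.map LinearMap.id
          ((αh.act g₀⁻¹ : Ahat →ₗ[ℂ] Ahat)) w), ⟨_, rfl⟩, fun x hx => ?_⟩
        have hmem : x * g₀⁻¹ ∈ E.inl.range := by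
          rw [E.range_inl_eq_ker_rightHom, MonoidHom.mem_ker, map_mul, map_inv]
          exact mul_inv_eq_one.2 hx
        obtain ⟨z, hz⟩ := hmem
        have hx' : x = E.inl z * g₀ := by simp [hz]
        have hval : ∀ w, αh.ellwoodMap (TensorProduct.map LinearMap.id
            ((αh.act g₀⁻¹ : Ahat →ₗ[ℂ] Ahat)) w) x = θ.ellwoodMap w z := by
          intro w
          induction w with
          | zero => simp
          | add a b ha hb => simp only [map_add, ContinuousMap.add_apply, ha, hb]
          | tmul a b =>
            change a * αh.act x (αh.act g₀⁻¹ b) = a * θ.act z b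
            rw [← StarAlgEquiv.mul_apply, ← map_mul, ← hz, hres]
        rw [hval, hx']
        refine (ContinuousMap.norm_coe_le_norm (φ - θ.ellwoodMap w) z).trans_lt ?_
        rwa [← dist_eq_norm]
    intro f
    have : f ∈ (LinearMap.range αh.ellwoodMap).topologicalClosure := htop ▸ trivial
    exact this
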